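/- Let $k\ge 0$ be an integer and call a group a $\mathrm{Nil}_k$-group if it is nilpotent of class at most $k$. Let $A$ be a finitely generated free group of the variety of $\mathrm{Nil}_k$-groups; that is, $A$ is a $\mathrm{Nil}_k$-group having a finite family $b_1,\dots,b_n$ of elements such that for every $\mathrm{Nil}_k$-group $H$ and all $h_1,\dots,h_n\in H$ there is a unique homomorphism $\varphi:A\to H$ with $\varphi(b_i)=h_i$ for all $i$. An $A$-free group is a free product of a non-empty family of copies of $A$. A group $G$ is fully residually $A$-free if for every finite set of non-identity elements $g_1,\dots,g_m\in G$ there is a homomorphism $\alpha$ from $G$ to some $A$-free group with $\alpha(g_i)\ne 1$ for all $1\le i\le m$. A group $G$ is $\mathrm{CSN}_k$ if every maximal $\mathrm{Nil}_k$-subgroup $H$ of $G$ (maximal with respect to inclusion among the $\mathrm{Nil}_k$-subgroups of $G$) is malnormal, that is, $H\cap x^{-1}Hx=1$ for all $x\in G\setminus H$. Then every fully residually $A$-free group is $\mathrm{CSN}_k$. -/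

import Mathlib

universe u v w

/-- A group is `Nil k` if it is nilpotent of class at most `k`. -/
def IsNilClass (k : ℕ) (H : Type u) [Group H] : Prop :=
  Group.IsNilpotent H ∧ Group.nilpotencyClass H ≤ k

/-- A subgroup `H` of `G` is malnormal if `H ∩ x⁻¹ H x = 1` for every `x ∈ G \ H`. -/
def IsMalnormal {G : Type u} [Group G] (H : Subgroup G) : Prop :=
  ∀ x : G, x ∉ H → H ⊓ H.map (MulAut.conj x⁻¹).toMonoidHom = ⊥

/-- `G` is a CSN`k` group: every maximal subgroup among the subgroups of `G` that are nilpotent of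
class at most `k` is malnormal in `G`. -/
def IsCSN (k : ℕ) (G : Type u) [Group G] : Prop :=
  ∀ H : Subgroup G, Maximal (fun K : Subgroup G => IsNilClass k K) H → IsMalnormal H

/-- `b` is a free basis of `A` in the variety of nilpotent groups of class at most `k`. -/
def IsFreeNilBasis (k : ℕ) {A : Type v} [Group A] {n : ℕ} (b : Fin n → A) : Prop :=
  IsNilClass k A ∧
    ∀ (H : Type v) [Group H], IsNilClass k H →
      ∀ f : Fin n → H, ∃! φ : A →* H, ∀ i, φ (b i) = f i

/-- `A` is a finitely generated free element of the variety of nilpotent groups of class at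
most `k`. -/
def IsFGFreeNil (k : ℕ) (A : Type v) [Group A] : Prop :=
  ∃ (n : ℕ) (b : Fin n → A), IsFreeNilBasis k b

/-- The `A`-free group on an index type `ι`: the free product of `ι` copies of `A`. -/
abbrev AFreeGroup (A : Type v) [Group A] (ι : Type w) : Type (max v w) :=
  Monoid.CoprodI (fun _ : ι => A)

/-- `G` is fully residually `A`-free: for any finite set of non-identity elements of `G` there is a
homomorphism from `G` to some `A`-free group (a free product of a non-empty family of copies of
`A`) that sends none of them to `1`. -/
def IsFullyResiduallyAFree (A : Type v) [Group A] (G : Type u) [Group G] : Prop :=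
  ∀ S : Finset G, (∀ g ∈ S, g ≠ 1) →
    ∃ (ι : Type w) (_ : Nonempty ι) (α : G →* AFreeGroup A ι), ∀ g ∈ S, α g ≠ 1

/-! Suppose a maximal `Nil k` subgroup `H` meets its conjugate by some `x ∉ H` in `h ≠ 1`. By
maximality `⟨H, x⟩` is not `Nil k`, so the term of its lower central series that class `k` would
kill contains some `y ≠ 1`. A homomorphism to an `A`-free group that kills neither `h` nor `y`
reduces everything to a statement about free products: there, a `Nil k` subgroup `K` with `h, x * h
* x⁻¹ ∈ K`, `h ≠ 1`, lies together with `x` in one `Nil k` subgroup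
(`exists_isNilClass_of_conj_mem`). That forces `y ↦ 1`, a contradiction.

For the free product, take `z ≠ 1` central in `K`. If `z` is conjugate into a factor, malnormality
of factors puts `K` and `x` in a conjugate of that factor. Otherwise, up to conjugation, `z` is a
cyclically reduced word translating a periodic ray. Everything commuting with `z` fixes the end of
the ray, and the stabilizer of that end is abelian, as its elements are determined by an integer
shift. Some powers of `h` and `x * h * x⁻¹` are nontrivial powers of `z`, so `x` fixes the end too,
unless it reverses the axis as in an infinite dihedral group (`RayShift.of_conj`).

Axis reversal needs elements of order two. These are absent from the free product once they are
absent from `A`, which is proved by building the free nilpotent group through iterated extensions by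
`ℤ`, eliminating one generator at a time. -/

open scoped commutatorElement

/-! ### Central filtrations and the lower central series. -/

/-- `F` is a descending filtration of `G` by subgroups of length `k`, starting at `G` and
compatible with commutators; the term `F i` plays the role of the `i`-th term of the lower
central series. -/
structure IsCentralFiltration (k : ℕ) {G : Type u} [Group G] (F : ℕ → Subgroup G) : Prop where
  anti : Antitone F
  zero_eq_top : F 0 = ⊤
  eq_bot : F k = ⊥
  comm : ∀ i j, ∀ x ∈ F i, ∀ y ∈ F j, ⁅x, y⁆ ∈ F (i + j + 1)

namespace IsCentralFiltration

variable {k : ℕ} {G : Type u} [Group G] {F : ℕ → Subgroup G}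

theorem conj_mem (hF : IsCentralFiltration k F) {i : ℕ} {x : G} (hx : x ∈ F i) (g : G) :
    g * x * g⁻¹ ∈ F i := by
  have h := hF.comm 0 i g (by simp [hF.zero_eq_top]) x hx
  have h' := hF.anti (show i ≤ 0 + i + 1 by omega) h
  have := mul_mem h' hx
  simpa [commutatorElement_def] using this

theorem eq_one_of_le (hF : IsCentralFiltration k F) {i : ℕ} (hi : k ≤ i) {x : G} (hx : x ∈ F i) :
    x = 1 := by
  have := hF.anti hi hx
  rwa [hF.eq_bot, Subgroup.mem_bot] at this

theorem lowerCentralSeries_le (hF : IsCentralFiltration k F) (i : ℕ) :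
    (⊤ : Subgroup G).lowerCentralSeries i ≤ F i := by
  induction i with
  | zero => rw [hF.zero_eq_top]; exact le_top
  | succ i ih =>
    rw [Subgroup.lowerCentralSeries_succ, Subgroup.commutator_le]
    intro x hx y _
    exact hF.comm i 0 x (ih hx) y (by simp [hF.zero_eq_top])

end IsCentralFiltration

theorem isNilClass_iff {k : ℕ} {G : Type u} [Group G] :
    IsNilClass k G ↔ (⊤ : Subgroup G).lowerCentralSeries k = ⊥ := by
  constructor
  · rintro ⟨h1, h2⟩
    exact Subgroup.lowerCentralSeries_eq_bot_iff_nilpotencyClass_le.mpr h2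
  · intro h
    have : Group.IsNilpotent G := Subgroup.nilpotent_iff_lowerCentralSeries.mpr ⟨k, h⟩
    exact ⟨this, Subgroup.lowerCentralSeries_eq_bot_iff_nilpotencyClass_le.mp h⟩

/-- The three subgroups lemma in the quotient by `N`. -/
theorem commutator_commutator_le_of_rotate {G : Type u} [Group G] {H₁ H₂ H₃ N : Subgroup G}
    [N.Normal] (h1 : ⁅⁅H₂, H₃⁆, H₁⁆ ≤ N) (h2 : ⁅⁅H₃, H₁⁆, H₂⁆ ≤ N) : ⁅⁅H₁, H₂⁆, H₃⁆ ≤ N := by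
  have key : ∀ K : Subgroup G, K.map (QuotientGroup.mk' N) = ⊥ ↔ K ≤ N := by
    intro K
    rw [Subgroup.map_eq_bot_iff, QuotientGroup.ker_mk']
  rw [← key, Subgroup.map_commutator, Subgroup.map_commutator] at h1 h2 ⊢
  exact Subgroup.commutator_commutator_eq_bot_of_rotate h1 h2

theorem commutator_lowerCentralSeries_le {G : Type u} [Group G] (i j : ℕ) :
    ⁅(⊤ : Subgroup G).lowerCentralSeries i, (⊤ : Subgroup G).lowerCentralSeries j⁆ ≤
      (⊤ : Subgroup G).lowerCentralSeries (i + j + 1) := by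
  induction i generalizing j with
  | zero =>
    rw [Subgroup.commutator_comm, Subgroup.lowerCentralSeries_zero, Nat.zero_add,
      Subgroup.lowerCentralSeries_succ]
  | succ i ih =>
    rw [Subgroup.lowerCentralSeries_succ]
    apply commutator_commutator_le_of_rotate
    · rw [Subgroup.commutator_comm ⊤, ← Subgroup.lowerCentralSeries_succ,
        Subgroup.commutator_comm]
      exact (ih (j + 1)).trans_eq (by congr 1; omega)
    · rw [Subgroup.commutator_comm (Subgroup.lowerCentralSeries _ j)]
      refine (Subgroup.commutator_mono (ih j) le_rfl).trans_eq ?_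
      rw [← Subgroup.lowerCentralSeries_succ]
      congr 1; omega

theorem IsNilClass.isCentralFiltration {k : ℕ} {G : Type u} [Group G] (h : IsNilClass k G) :
    IsCentralFiltration k (fun i => (⊤ : Subgroup G).lowerCentralSeries i) where
  anti := Subgroup.lowerCentralSeries_antitone _
  zero_eq_top := Subgroup.lowerCentralSeries_zero _
  eq_bot := isNilClass_iff.mp h
  comm i j _ hx _ hy :=
    commutator_lowerCentralSeries_le i j (Subgroup.commutator_mem_commutator hx hy)

/-! ### Free filtered groups, elimination, and absence of 2-torsion in `A`. -/

/-- `e : X → N` exhibits the filtered group `(N, F)` as the free object on generators `x` lying in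
the `d x`-th term of the filtration. -/
structure IsFreeFiltered (k : ℕ) {X : Type} (d : X → ℕ) {N : Type v} [Group N]
    (F : ℕ → Subgroup N) (e : X → N) : Prop where
  filt : IsCentralFiltration k F
  mem : ∀ x, e x ∈ F (d x)
  closure : Subgroup.closure (Set.range e) = ⊤
  lift : ∀ (G : Type v) [Group G] (F' : ℕ → Subgroup G), IsCentralFiltration k F' →
    ∀ f : X → G, (∀ x, f x ∈ F' (d x)) →
      ∃ φ : N →* G, (∀ x, φ (e x) = f x) ∧ ∀ i, ∀ n ∈ F i, φ n ∈ F' i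

namespace IsFreeFiltered

variable {k : ℕ} {X : Type} {d : X → ℕ} {N : Type v} [Group N] {F : ℕ → Subgroup N} {e : X → N}

theorem hom_ext (h : IsFreeFiltered k d F e) {G : Type u} [Group G] {φ ψ : N →* G}
    (hφ : ∀ x, φ (e x) = ψ (e x)) : φ = ψ :=
  MonoidHom.eq_of_eqOn_dense h.closure (by rintro _ ⟨x, rfl⟩; exact hφ x)

/-- The universal property gives a filtered map into `S 0`. Composed with the inclusion it fixes the
generators, so it is the identity, and `F` is the least filtration compatible with the generators.
-/
theorem le_of_mem (h : IsFreeFiltered k d F e) (S : ℕ → Subgroup N) (hanti : Antitone S)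
    (hle : S k = ⊥) (hcomm : ∀ i j, ∀ x ∈ S i, ∀ y ∈ S j, ⁅x, y⁆ ∈ S (i + j + 1))
    (he : ∀ x, e x ∈ S (d x)) (i : ℕ) : F i ≤ S i := by
  have hS : IsCentralFiltration k (fun i => (S i).subgroupOf (S 0)) :=
    { anti := fun i j hij x hx => hanti hij hx
      zero_eq_top := Subgroup.subgroupOf_self _
      eq_bot := by simp [hle]
      comm := fun i j x hx y hy => by
        rw [Subgroup.mem_subgroupOf] at *
        exact hcomm i j x hx y hy }
  obtain ⟨φ, hφ, hF⟩ := h.lift (S 0) _ hS (fun x => ⟨e x, hanti (Nat.zero_le _) (he x)⟩) he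
  have : (S 0).subtype.comp φ = MonoidHom.id N := h.hom_ext (by simp [hφ])
  intro n hn
  have h2 := hF i n hn
  rw [Subgroup.mem_subgroupOf] at h2
  have h3 := DFunLike.congr_fun this n
  simp only [MonoidHom.comp_apply, Subgroup.coe_subtype, MonoidHom.id_apply] at h3
  rwa [h3] at h2

/-- An endomorphism that moves every generator by an element of filtration degree shifted by
`D + 1` does so on every term of the filtration. -/
theorem shift_mem (h : IsFreeFiltered k d F e) {D : ℕ} (φ : N →* N)
    (hφ : ∀ x, φ (e x) * (e x)⁻¹ ∈ F (d x + D + 1)) (i : ℕ) {n : N} (hn : n ∈ F i) :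
    φ n * n⁻¹ ∈ F (i + D + 1) := by
  have hF := h.filt
  let S : ℕ → Subgroup N := fun i =>
    { carrier := {n | n ∈ F i ∧ φ n * n⁻¹ ∈ F (i + D + 1)}
      one_mem' := ⟨one_mem _, by simp⟩
      mul_mem' := by
        rintro a b ⟨ha, ha'⟩ ⟨hb, hb'⟩
        refine ⟨mul_mem ha hb, ?_⟩
        have := mul_mem (hF.conj_mem hb' (φ a)) ha'
        simpa [mul_assoc] using this
      inv_mem' := by
        rintro a ⟨ha, ha'⟩
        refine ⟨inv_mem ha, ?_⟩
        have := hF.conj_mem (inv_mem ha') (φ a)⁻¹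
        simpa [mul_assoc] using this }
  have key : F i ≤ S i := by
    refine h.le_of_mem S ?_ ?_ ?_ (fun x => ⟨h.mem x, hφ x⟩) i
    · rintro i j hij n ⟨h1, h2⟩
      exact ⟨hF.anti hij h1, hF.anti (by omega) h2⟩
    · rw [eq_bot_iff]
      rintro n ⟨h1, -⟩
      rwa [hF.eq_bot] at h1
    · rintro i j a ⟨ha, ha'⟩ b ⟨hb, hb'⟩
      refine ⟨hF.comm i j a ha b hb, ?_⟩
      obtain ⟨c, hc⟩ : ∃ c, c = φ a * a⁻¹ := ⟨_, rfl⟩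
      obtain ⟨c', hc'⟩ : ∃ c', c' = φ b * b⁻¹ := ⟨_, rfl⟩
      rw [← hc] at ha'
      rw [← hc'] at hb'
      have ea : φ a = c * a := by rw [hc]; group
      have eb : φ b = c' * b := by rw [hc']; group
      have hcb : c' * b ∈ F j := mul_mem (hF.anti (by omega) hb') hb
      have t1 : ⁅c, c' * b⁆ ∈ F (i + j + 1 + D + 1) :=
        hF.anti (by omega) (hF.comm _ _ c ha' _ hcb)
      have t2 : ⁅a, c'⁆ ∈ F (i + j + 1 + D + 1) := hF.anti (by omega) (hF.comm _ _ a ha _ hb')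
      have t3 : ⁅c', ⁅a, b⁆⁆ ∈ F (i + j + 1 + D + 1) :=
        hF.anti (by omega) (hF.comm _ _ c' hb' _ (hF.comm _ _ a ha b hb))
      rw [map_commutatorElement, ea, eb]
      have t4 : ⁅c, ⁅a, b⁆⁆ ∈ F (i + j + 1 + D + 1) :=
        hF.anti (by omega) (hF.comm _ _ c ha' _ (hF.comm _ _ a ha b hb))
      -- Up to conjugation, every factor on the right is a commutator involving `c` or `c'`, each of
      -- which lies `D + 1` levels deeper than `a` or `b`.
      have : ⁅c * a, c' * b⁆ * ⁅a, b⁆⁻¹ =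
          c * (⁅a, c'⁆ * ⁅c', ⁅a, b⁆⁆) * c⁻¹ * ⁅c, ⁅a, b⁆⁆ *
          (⁅a, b⁆ * ⁅c, c' * b⁆ * ⁅a, b⁆⁻¹) := by
        simp only [commutatorElement_def]; group
      rw [this]
      exact mul_mem (mul_mem (hF.conj_mem (mul_mem t2 t3) _) t4) (hF.conj_mem t1 _)
  exact (key hn).2

end IsFreeFiltered

/-- A unipotent endomorphism of a filtered group is bijective. -/
theorem IsCentralFiltration.bijective_of_shift {k : ℕ} {N : Type u} [Group N] {F : ℕ → Subgroup N}
    (hF : IsCentralFiltration k F) {D : ℕ} (φ : N →* N)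
    (hφ : ∀ i, ∀ n ∈ F i, φ n * n⁻¹ ∈ F (i + D + 1)) : Function.Bijective φ := by
  constructor
  · rw [injective_iff_map_eq_one]
    intro n hn
    have : ∀ i, n ∈ F i := by
      intro i
      induction i with
      | zero => simp [hF.zero_eq_top]
      | succ i ih =>
        have := hφ i n ih
        rw [hn, one_mul, inv_mem_iff] at this
        exact hF.anti (by omega) this
    exact hF.eq_one_of_le le_rfl (this k)
  -- Descending induction on the level `i`: the error `φ n * n⁻¹` lies deeper, hence already in the
  -- range.
  · have : ∀ j i, k ≤ i + j → ∀ n ∈ F i, n ∈ φ.range := by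
      intro j
      induction j with
      | zero =>
        intro i hi n hn
        rw [hF.eq_one_of_le hi hn]
        exact one_mem _
      | succ j ih =>
        intro i hi n hn
        have h1 := ih (i + D + 1) (by omega) _ (hφ i n hn)
        have h2 := mul_mem (inv_mem h1) (⟨n, rfl⟩ : φ n ∈ φ.range)
        simpa using h2
    intro n
    exact this k 0 (by omega) n (by simp [hF.zero_eq_top])

theorem IsCentralFiltration.shift_symm {k : ℕ} {N : Type u} [Group N] {F : ℕ → Subgroup N}
    (hF : IsCentralFiltration k F) {D : ℕ} (φ : N ≃* N)
    (hφ : ∀ i, ∀ n ∈ F i, φ n * n⁻¹ ∈ F (i + D + 1)) :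
    ∀ i, ∀ n ∈ F i, φ.symm n * n⁻¹ ∈ F (i + D + 1) := by
  have : ∀ j i, k ≤ i + j → ∀ n ∈ F i, φ.symm n * n⁻¹ ∈ F (i + D + 1) := by
    intro j
    induction j with
    | zero =>
      intro i hi n hn
      rw [hF.eq_one_of_le hi hn]
      simp
    | succ j ih =>
      intro i hi n hn
      have h1 := hφ i n hn
      have h2 := ih (i + D + 1) (by omega) _ h1
      have h3 := mul_mem (hF.anti (by omega) h2 : _ ∈ F (i + D + 1)) h1
      rw [inv_mul_cancel_right] at h3
      have : φ.symm n * n⁻¹ = (φ.symm (φ n * n⁻¹))⁻¹ := by simp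
      rw [this]
      exact inv_mem h3
  intro i n hn
  exact this k i (by omega) n hn

theorem IsCentralFiltration.shift_zpow {k : ℕ} {N : Type u} [Group N] {F : ℕ → Subgroup N}
    (hF : IsCentralFiltration k F) {D : ℕ} (φ : MulAut N)
    (hφ : ∀ i, ∀ n ∈ F i, φ n * n⁻¹ ∈ F (i + D + 1)) (z : ℤ) :
    ∀ i, ∀ n ∈ F i, (φ ^ z) n * n⁻¹ ∈ F (i + D + 1) := by
  have hmul : ∀ φ ψ : MulAut N, (∀ i, ∀ n ∈ F i, φ n * n⁻¹ ∈ F (i + D + 1)) →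
      (∀ i, ∀ n ∈ F i, ψ n * n⁻¹ ∈ F (i + D + 1)) →
      ∀ i, ∀ n ∈ F i, (φ * ψ) n * n⁻¹ ∈ F (i + D + 1) := by
    intro φ ψ h1 h2 i n hn
    have a := h2 i n hn
    have b := h1 i _ (mul_mem (hF.anti (by omega) a : _ ∈ F i) hn)
    have := mul_mem b a
    simpa [mul_assoc] using this
  induction z using Int.induction_on with
  | zero => intro i n _; simp
  | succ z ih => rw [zpow_add_one]; exact hmul _ _ ih hφ
  | pred z ih => rw [zpow_sub_one]; exact hmul _ _ ih (hF.shift_symm φ hφ)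

/-- The filtration of a semidirect product `N ⋊ ℤ` in which the generator of `ℤ` has degree `D`. -/
def semidirectFiltration {N : Type u} [Group N] (F : ℕ → Subgroup N)
    (ρ : Multiplicative ℤ →* MulAut N) (D : ℕ) (hρ : ∀ i z, ∀ n ∈ F i, ρ z n ∈ F i) (i : ℕ) :
    Subgroup (N ⋊[ρ] Multiplicative ℤ) where
  carrier := {g | g.left ∈ F i ∧ (g.right = 1 ∨ i ≤ D)}
  one_mem' := by simp
  mul_mem' := by
    rintro a b ⟨ha, ha'⟩ ⟨hb, hb'⟩
    refine ⟨mul_mem ha (hρ _ _ _ hb), ?_⟩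
    rcases ha' with h | h
    · rcases hb' with h' | h'
      · left; simp [h, h']
      · exact Or.inr h'
    · exact Or.inr h
  inv_mem' := by
    rintro a ⟨ha, ha'⟩
    refine ⟨hρ _ _ _ (inv_mem ha), ?_⟩
    rcases ha' with h | h
    · left; simp [h]
    · exact Or.inr h

/-- Commutators of `N` with the cyclic part are controlled by the shift `hs`, and two elements of
the cyclic part commute. The bound `D < k` keeps the cyclic part out of level `k`. -/
theorem isCentralFiltration_semidirect {k : ℕ} {N : Type u} [Group N] {F : ℕ → Subgroup N}
    (hF : IsCentralFiltration k F) (ρ : Multiplicative ℤ →* MulAut N) {D : ℕ} (hD : D < k)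
    (hρ : ∀ i z, ∀ n ∈ F i, ρ z n ∈ F i)
    (hs : ∀ z i, ∀ n ∈ F i, ρ z n * n⁻¹ ∈ F (i + D + 1)) :
    IsCentralFiltration k (semidirectFiltration F ρ D hρ) where
  anti i j hij := by
    rintro g ⟨h1, h2⟩
    exact ⟨hF.anti hij h1, h2.imp id (fun h => hij.trans h)⟩
  zero_eq_top := by
    rw [eq_top_iff]
    rintro g -
    exact ⟨by simp [hF.zero_eq_top], Or.inr (Nat.zero_le _)⟩
  eq_bot := by
    rw [eq_bot_iff]
    rintro g ⟨h1, h2⟩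
    rw [Subgroup.mem_bot]
    ext
    · exact hF.eq_one_of_le le_rfl h1
    · exact congrArg _ (h2.resolve_right (by omega))
  comm := by
    rintro i j ⟨a, s⟩ ⟨ha, hs'⟩ ⟨b, t⟩ ⟨hb, ht'⟩
    dsimp only at ha hs' hb ht'
    have h1 : ρ s b * b⁻¹ ∈ F (i + j + 1) := by
      rcases hs' with rfl | h
      · simp
      · exact hF.anti (by omega) (hs s j b hb)
    have h2 : ρ t a * a⁻¹ ∈ F (i + j + 1) := by
      rcases ht' with rfl | h
      · simp
      · exact hF.anti (by omega) (hs t i a ha)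
    refine ⟨?_, Or.inl (by simp [commutatorElement_def])⟩
    have e : (⁅(⟨a, s⟩ : N ⋊[ρ] Multiplicative ℤ), (⟨b, t⟩ : N ⋊[ρ] Multiplicative ℤ)⁆ :
        N ⋊[ρ] Multiplicative ℤ).left =
        a * ρ s b * (ρ t a)⁻¹ * b⁻¹ := by
      have hst : ∀ x : N, ρ s (ρ t x) = ρ t (ρ s x) := by
        intro x
        rw [← MulAut.mul_apply, ← MulAut.mul_apply, ← map_mul, ← map_mul, mul_comm]
      simp [commutatorElement_def, hst]
    rw [e]
    have : a * ρ s b * (ρ t a)⁻¹ * b⁻¹ =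
        (a * (ρ s b * b⁻¹) * a⁻¹) * ⁅a, b⁆ * (b * (ρ t a * a⁻¹)⁻¹ * b⁻¹) := by
      simp only [commutatorElement_def]; group
    rw [this]
    exact mul_mem (mul_mem (hF.conj_mem h1 _) (hF.comm _ _ a ha b hb))
      (hF.conj_mem (inv_mem h2) _)

theorem map_zpow_conj {N : Type u} {G : Type v} [Group N] [Group G] (ψ : N →* G) (φ : MulAut N)
    (c : G) (h : ∀ n, ψ (φ n) = c * ψ n * c⁻¹) (z : ℤ) (n : N) :
    ψ ((φ ^ z) n) = c ^ z * ψ n * (c ^ z)⁻¹ := by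
  have h' : ∀ n, ψ (φ⁻¹ n) = c⁻¹ * ψ n * c := by
    intro n
    have := h (φ⁻¹ n)
    rw [MulAut.apply_inv_self] at this
    rw [this]; group
  induction z using Int.induction_on generalizing n with
  | zero => simp
  | succ z ih => rw [zpow_add_one, MulAut.mul_apply, ih, h, zpow_add_one]; group
  | pred z ih => rw [zpow_sub_one, MulAut.mul_apply, ih, h', zpow_sub_one]; group

/-- The degrees of the generators `[y, …, [y, x]]` obtained by eliminating the generator `y`. -/
def elimDegree {X : Type} (d : X → ℕ) (y : X) (p : {x : X // x ≠ y} × ℕ) : ℕ :=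
  d p.1 + p.2 * (d y + 1)

/-- Elimination of the generator `y` : the free filtered group is the semidirect product of a
free filtered group on the iterated commutators `[y, …, [y, x]]` with an infinite cyclic group. -/
theorem IsFreeFiltered.elimination {k : ℕ} {X : Type} (d : X → ℕ) (y : X) (hy : d y < k)
    {N : Type v} [Group N] {F : ℕ → Subgroup N} {e : {x : X // x ≠ y} × ℕ → N}
    (h : IsFreeFiltered k (elimDegree d y) F e) (htf : ∀ n : N, n ^ 2 = 1 → n = 1) :
    ∃ (M : Type v) (_ : Group M) (F' : ℕ → Subgroup M) (e' : X → M),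
      IsFreeFiltered k d F' e' ∧ ∀ n : M, n ^ 2 = 1 → n = 1 := by
  classical
  have hF := h.filt
  -- This is meant to be conjugation by `y`: since `y g y⁻¹ = [y, g] g` and `e (x, i + 1)` stands
  -- for `[y, e (x, i)]`, the image of `e p` is forced.
  obtain ⟨φ₀, hφ₀, -⟩ := h.lift N F hF (fun p => e (p.1, p.2 + 1) * e p) (fun p => by
    refine mul_mem (hF.anti ?_ (h.mem (p.1, p.2 + 1))) (h.mem p)
    simp only [elimDegree, add_mul]; omega)
  have hshift : ∀ i, ∀ n ∈ F i, φ₀ n * n⁻¹ ∈ F (i + d y + 1) := fun i n hn =>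
    h.shift_mem φ₀ (fun p => by
      rw [hφ₀, mul_inv_cancel_right]
      refine hF.anti ?_ (h.mem (p.1, p.2 + 1))
      simp only [elimDegree, add_mul]; omega) i hn
  let φ : MulAut N := MulEquiv.ofBijective φ₀ (hF.bijective_of_shift φ₀ hshift)
  have hφ : ∀ n, φ n = φ₀ n := fun _ => rfl
  let ρ : Multiplicative ℤ →* MulAut N := zpowersHom _ φ
  have hρz : ∀ z, ρ z = φ ^ z.toAdd := fun z => by simp [ρ]
  have hs : ∀ z i, ∀ n ∈ F i, ρ z n * n⁻¹ ∈ F (i + d y + 1) := fun z => by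
    rw [hρz]; exact hF.shift_zpow φ hshift _
  have hρ : ∀ i z, ∀ n ∈ F i, ρ z n ∈ F i := fun i z n hn => by
    have := mul_mem (hF.anti (by omega) (hs z i n hn) : _ ∈ F i) hn
    simpa using this
  let e' : X → N ⋊[ρ] Multiplicative ℤ := fun x =>
    if hx : x = y then SemidirectProduct.inr (Multiplicative.ofAdd 1)
    else SemidirectProduct.inl (e (⟨x, hx⟩, 0))
  have he'y : e' y = SemidirectProduct.inr (Multiplicative.ofAdd 1) := dif_pos rfl
  have he' : ∀ x : {x // x ≠ y}, e' x = SemidirectProduct.inl (e (x, 0)) :=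
    fun x => dif_neg x.2
  refine ⟨N ⋊[ρ] Multiplicative ℤ, inferInstance, semidirectFiltration F ρ (d y) hρ, e',
    ⟨isCentralFiltration_semidirect hF ρ hy hρ hs, ?_, ?_, ?_⟩, ?_⟩
  · intro x
    by_cases hx : x = y
    · rw [hx, he'y]
      exact ⟨one_mem _, Or.inr le_rfl⟩
    · rw [he' ⟨x, hx⟩]
      refine ⟨?_, Or.inl rfl⟩
      simpa [elimDegree] using h.mem (⟨x, hx⟩, 0)
  · set C := Subgroup.closure (Set.range e')
    have hyC : SemidirectProduct.inr (Multiplicative.ofAdd 1) ∈ C :=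
      he'y ▸ Subgroup.subset_closure ⟨y, rfl⟩
    have hr : ∀ z : Multiplicative ℤ, SemidirectProduct.inr z ∈ C := by
      intro z
      have := zpow_mem hyC z.toAdd
      rwa [← map_zpow, ← ofAdd_zsmul, smul_eq_mul, mul_one, ofAdd_toAdd] at this
    have hφC : ∀ n, SemidirectProduct.inl (φ n) =
        SemidirectProduct.inr (Multiplicative.ofAdd 1) * (SemidirectProduct.inl n : N ⋊[ρ] _) *
          SemidirectProduct.inr (Multiplicative.ofAdd 1)⁻¹ := by
      intro n
      rw [← SemidirectProduct.inl_aut, hρz]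
      simp
    have hl : ∀ (x : {x // x ≠ y}) (i : ℕ), SemidirectProduct.inl (e (x, i)) ∈ C := by
      intro x i
      induction i with
      | zero => exact he' x ▸ Subgroup.subset_closure ⟨x, rfl⟩
      | succ i ih =>
        have e1 := hφC (e (x, i))
        rw [hφ, hφ₀, map_mul] at e1
        rw [eq_mul_inv_of_mul_eq e1]
        exact mul_mem (mul_mem (mul_mem hyC ih) (hr _)) (inv_mem ih)
    have hcl : (⊤ : Subgroup N) ≤ C.comap SemidirectProduct.inl := by
      rw [← h.closure, Subgroup.closure_le]
      rintro _ ⟨⟨x, i⟩, rfl⟩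
      exact hl x i
    rw [eq_top_iff]
    intro g _
    rw [← SemidirectProduct.inl_left_mul_inr_right g]
    exact mul_mem (hcl (Subgroup.mem_top g.left)) (hr _)
  · intro G _ F' hF' f hf
    let f' : {x // x ≠ y} × ℕ → G := fun p => (fun g => ⁅f y, g⁆)^[p.2] (f p.1)
    have hf'succ : ∀ x i, f' (x, i + 1) = ⁅f y, f' (x, i)⁆ := fun x i =>
      Function.iterate_succ_apply' _ _ _
    obtain ⟨ψ, hψ, hψF⟩ := h.lift G F' hF' f' (by
      rintro ⟨x, i⟩
      induction i with
      | zero => simpa [elimDegree, f'] using hf x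
      | succ i ih =>
        rw [hf'succ]
        refine hF'.anti ?_ (hF'.comm _ _ _ (hf y) _ ih)
        simp only [elimDegree, add_mul]; omega)
    have hcomp : ∀ n, ψ (φ n) = f y * ψ n * (f y)⁻¹ := by
      have : ψ.comp φ₀ = (MulAut.conj (f y)).toMonoidHom.comp ψ := by
        apply h.hom_ext
        rintro ⟨x, i⟩
        simp [hφ₀, hψ, hf'succ, commutatorElement_def]
      intro n
      exact DFunLike.congr_fun this n
    let θ := SemidirectProduct.lift (φ := ρ) ψ (zpowersHom G (f y)) (by
      intro z
      ext n
      change ψ (ρ z n) = f y ^ z.toAdd * ψ n * (f y ^ z.toAdd)⁻¹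
      rw [hρz]
      exact map_zpow_conj ψ φ (f y) hcomp z.toAdd n)
    refine ⟨θ, ?_, ?_⟩
    · intro x
      by_cases hx : x = y
      · rw [hx, he'y]; simp [θ]
      · rw [he' ⟨x, hx⟩]; simp [θ, hψ, f']
    · rintro i g ⟨h1, h2⟩
      rw [← SemidirectProduct.inl_left_mul_inr_right g, map_mul]
      refine mul_mem ?_ ?_
      · simpa [θ] using hψF i _ h1
      · rcases h2 with h2 | h2
        · rw [h2]; simp
        · simpa [θ] using zpow_mem (hF'.anti h2 (hf y)) _
  · rintro ⟨a, s⟩ hg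
    -- Project to `ℤ`, which is torsion-free, and then use the hypothesis on `N`.
    have h1 : s = 1 := by
      have := congrArg SemidirectProduct.right hg
      simp only [pow_two, SemidirectProduct.mul_right, SemidirectProduct.one_right] at this
      have h3 := congrArg Multiplicative.toAdd this
      rw [toAdd_mul, toAdd_one] at h3
      apply Multiplicative.toAdd.injective
      rw [toAdd_one]; omega
    subst h1
    have h2 : a ^ 2 = 1 := by
      have := congrArg SemidirectProduct.left hg
      simpa [pow_two] using this
    rw [htf a h2]; rfl

/-- Double induction: on `j`, which bounds how far degrees lie below `k`, and on the number `c` of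
generators of the lowest allowed degree `k - (j + 1)`. Eliminating such a `y` lowers `c` by one, as
the new generators with `i ≥ 1` have larger degree. At `j = 0` all generators have degree at least
`k` and the trivial group is free on them. -/
theorem exists_isFreeFiltered (k j : ℕ) : ∀ (X : Type) (d : X → ℕ), (∀ x, k ≤ d x + j) →
    {x | d x < k}.Finite →
    ∃ (N : Type v) (_ : Group N) (F : ℕ → Subgroup N) (e : X → N),
      IsFreeFiltered k d F e ∧ ∀ n : N, n ^ 2 = 1 → n = 1 := by
  induction j with
  | zero =>
    intro X d hd _
    refine ⟨PUnit, inferInstance, fun _ => ⊤, fun _ => 1, ⟨⟨?_, rfl, ?_, ?_⟩, ?_, ?_, ?_⟩, ?_⟩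
    · exact antitone_const
    · exact Subsingleton.elim _ _
    · intros; trivial
    · intros; trivial
    · exact Subsingleton.elim _ _
    · intro G _ F' hF' f hf
      refine ⟨1, fun x => ?_, fun i n _ => one_mem _⟩
      rw [hF'.eq_one_of_le (by simpa using hd x) (hf x)]; rfl
    · intros; rfl
  | succ j ih =>
    have main : ∀ (c : ℕ) (X : Type) (d : X → ℕ), (∀ x, k ≤ d x + (j + 1)) →
        {x | d x < k}.Finite → {x | d x < k ∧ d x + (j + 1) = k}.ncard = c →
        ∃ (N : Type v) (_ : Group N) (F : ℕ → Subgroup N) (e : X → N),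
          IsFreeFiltered k d F e ∧ ∀ n : N, n ^ 2 = 1 → n = 1 := by
      intro c
      induction c with
      | zero =>
        intro X d hd hfin hc
        rw [Set.ncard_eq_zero (hfin.subset fun x hx => hx.1)] at hc
        refine ih X d (fun x => ?_) hfin
        have h1 := hd x
        by_contra hlt
        have : x ∈ {x | d x < k ∧ d x + (j + 1) = k} := ⟨by omega, by omega⟩
        rw [hc] at this
        exact this
      | succ c ihc =>
        intro X d hd hfin hc
        have hne : {x | d x < k ∧ d x + (j + 1) = k}.ncard ≠ 0 := by omega
        obtain ⟨y, hyk, hyj⟩ := Set.nonempty_of_ncard_ne_zero hne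
        have hfin' : {p | elimDegree d y p < k}.Finite := by
          have : Function.Injective (fun p : {x // x ≠ y} × ℕ => ((p.1 : X), p.2)) := by
            rintro ⟨⟨a, _⟩, i⟩ ⟨⟨b, _⟩, i'⟩ hab
            simpa using hab
          refine ((hfin.prod (Set.finite_Iio k)).preimage this.injOn).subset ?_
          rintro ⟨x, i⟩ hx
          simp only [elimDegree, Set.mem_ofPred_eq, mul_add, mul_one] at hx
          have := Nat.zero_le (i * d y)
          exact ⟨by simp only [Set.mem_ofPred_eq]; omega, by simp only [Set.mem_Iio]; omega⟩
        have hc' : {p | elimDegree d y p < k ∧ elimDegree d y p + (j + 1) = k}.ncard = c := by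
          have himg : (fun p : {x // x ≠ y} × ℕ => (p.1 : X)) ''
              {p | elimDegree d y p < k ∧ elimDegree d y p + (j + 1) = k} =
              {x | d x < k ∧ d x + (j + 1) = k} \ {y} := by
            ext x
            simp only [Set.mem_image, Set.mem_ofPred_eq, Set.mem_sdiff, Set.mem_singleton_iff,
              Prod.exists]
            constructor
            · rintro ⟨x, i, ⟨h1, h2⟩, rfl⟩
              have := hd x
              simp only [elimDegree] at h1 h2
              exact ⟨⟨by omega, by omega⟩, x.2⟩
            · rintro ⟨⟨h1, h2⟩, h3⟩
              exact ⟨⟨x, h3⟩, 0, by simpa [elimDegree] using ⟨h1, h2⟩, rfl⟩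
          have hinj : Set.InjOn (fun p : {x // x ≠ y} × ℕ => (p.1 : X))
              {p | elimDegree d y p < k ∧ elimDegree d y p + (j + 1) = k} := by
            rintro ⟨a, i⟩ ⟨h1, h2⟩ ⟨b, i'⟩ ⟨h3, h4⟩ hab
            have hab : a = b := Subtype.ext hab
            subst hab
            simp only [elimDegree] at h2 h4
            have : i * (d y + 1) = i' * (d y + 1) := by omega
            rw [Nat.eq_of_mul_eq_mul_right (Nat.succ_pos _) this]
          rw [← hinj.ncard_image, himg,
            Set.ncard_sdiff_singleton_of_mem (by exact ⟨hyk, hyj⟩), hc]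
          rfl
        obtain ⟨N, _, F, e, h, htf⟩ := ihc ({x // x ≠ y} × ℕ) (elimDegree d y)
          (fun p => (hd p.1).trans (by simp only [elimDegree]; omega)) hfin' hc'
        exact h.elimination d y hyk htf
    intro X d hd hfin
    exact main _ X d hd hfin rfl

/-- A finitely generated free nilpotent group of class `k` has no elements of order two. -/
theorem IsFGFreeNil.eq_one_of_sq_eq_one {k : ℕ} {A : Type v} [Group A] (hA : IsFGFreeNil k A)
    (a : A) (ha : a ^ 2 = 1) : a = 1 := by
  obtain ⟨n, b, hnil, hb⟩ := hA
  -- With all generators in degree `0`, both universal properties apply and make `A` a retract of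
  -- `N`.
  obtain ⟨N, _, F, e, h, htf⟩ := exists_isFreeFiltered.{v} k k (Fin n) (fun _ => 0) (by simp)
    (Set.toFinite _)
  have hN : IsNilClass k N := by
    rw [isNilClass_iff, eq_bot_iff, ← h.filt.eq_bot]
    exact h.filt.lowerCentralSeries_le k
  obtain ⟨φ, hφ, -⟩ := hb N hN e
  obtain ⟨ψ, hψ, -⟩ := h.lift A _ hnil.isCentralFiltration b (by simp)
  obtain ⟨χ, -, huniq⟩ := hb A hnil b
  have : ψ.comp φ = MonoidHom.id A :=
    (huniq _ (by intro i; simp only [MonoidHom.comp_apply]; rw [hφ, hψ])).trans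
      (huniq _ (fun i => rfl)).symm
  have h1 : φ a = 1 := htf _ (by rw [← map_pow, ha, map_one])
  have h2 := DFunLike.congr_fun this a
  rw [MonoidHom.comp_apply, h1, map_one] at h2
  exact h2.symm

/-! ### Reduced words in free products. -/

open Monoid

section FreeProduct

variable {ι : Type w} {M : ι → Type v} [∀ i, Group (M i)]

/-- A list of letters is reduced if no letter is trivial and neighbours lie in distinct factors. -/
def IsReducedList (l : List (Σ i, M i)) : Prop :=
  (∀ x ∈ l, x.2 ≠ 1) ∧ l.IsChain (fun a b => a.1 ≠ b.1)

/-- The element of the free product represented by a list of letters. -/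
def listEval (l : List (Σ i, M i)) : CoprodI M :=
  (l.map fun x => CoprodI.of x.2).prod

@[simp] theorem listEval_nil : listEval ([] : List (Σ i, M i)) = 1 := rfl

@[simp] theorem listEval_cons (a : Σ i, M i) (l : List (Σ i, M i)) :
    listEval (a :: l) = CoprodI.of a.2 * listEval l := by simp [listEval]

@[simp] theorem listEval_append (l l' : List (Σ i, M i)) :
    listEval (l ++ l') = listEval l * listEval l' := by simp [listEval]

theorem IsReducedList.eq_of_listEval_eq {l l' : List (Σ i, M i)} (h : IsReducedList l)
    (h' : IsReducedList l') (he : listEval l = listEval l') : l = l' := by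
  classical
  have : (⟨l, h.1, h.2⟩ : CoprodI.Word M) = ⟨l', h'.1, h'.2⟩ :=
    CoprodI.Word.equiv.symm.injective he
  exact congrArg CoprodI.Word.toList this

theorem exists_isReducedList (g : CoprodI M) : ∃ l, IsReducedList l ∧ listEval l = g := by
  classical
  exact ⟨(CoprodI.Word.equiv g).toList, ⟨(CoprodI.Word.equiv g).ne_one,
    (CoprodI.Word.equiv g).chain_ne⟩, CoprodI.Word.equiv.symm_apply_apply g⟩

theorem isReducedList_append_iff {l l' : List (Σ i, M i)} :
    IsReducedList (l ++ l') ↔ IsReducedList l ∧ IsReducedList l' ∧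
      ∀ x ∈ l.getLast?, ∀ y ∈ l'.head?, x.1 ≠ y.1 := by
  simp only [IsReducedList, List.isChain_append, List.mem_append]
  constructor
  · rintro ⟨h1, h2, h3, h4⟩
    exact ⟨⟨fun x hx => h1 x (Or.inl hx), h2⟩, ⟨fun x hx => h1 x (Or.inr hx), h3⟩, h4⟩
  · rintro ⟨⟨h1, h2⟩, ⟨h3, h4⟩, h5⟩
    exact ⟨fun x hx => hx.elim (h1 x) (h3 x), h2, h4, h5⟩

theorem isReducedList_nil : IsReducedList ([] : List (Σ i, M i)) := ⟨by simp, by simp⟩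

theorem isReducedList_singleton {a : Σ i, M i} (ha : a.2 ≠ 1) : IsReducedList [a] :=
  ⟨by simpa using ha, by simp⟩

/-- Only the first letter is affected: it is cancelled, merged or preceded by `a`. The point is that
`u` does not depend on `t`. -/
theorem exists_reduced_mul_left (a h : Σ i, M i) (ha : a.2 ≠ 1) :
    ∃ u : List (Σ i, M i), ∀ t, IsReducedList (h :: t) →
      IsReducedList (u ++ t) ∧ listEval (u ++ t) = CoprodI.of a.2 * listEval (h :: t) := by
  classical
  obtain ⟨i, a⟩ := a
  obtain ⟨j, b⟩ := h
  by_cases hij : i = j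
  · subst hij
    by_cases hab : a * b = 1
    · refine ⟨[], fun t ht => ⟨?_, ?_⟩⟩
      · exact ((isReducedList_append_iff (l := [_])).mp ht).2.1
      · simp [← mul_assoc, ← map_mul, hab]
    · refine ⟨[⟨i, a * b⟩], fun t ht => ⟨?_, ?_⟩⟩
      · have := (isReducedList_append_iff (l := [_])).mp ht
        refine isReducedList_append_iff.mpr ⟨isReducedList_singleton hab, this.2.1, ?_⟩
        simpa using this.2.2
      · simp [mul_assoc]
  · refine ⟨[⟨i, a⟩, ⟨j, b⟩], fun t ht => ⟨?_, ?_⟩⟩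
    · exact (isReducedList_append_iff (l := [_])).mpr ⟨isReducedList_singleton ha, ht, by simpa⟩
    · simp

theorem exists_reduced_mul_right (a h : Σ i, M i) (ha : a.2 ≠ 1) :
    ∃ u : List (Σ i, M i), ∀ t, IsReducedList (t ++ [h]) →
      IsReducedList (t ++ u) ∧ listEval (t ++ u) = listEval (t ++ [h]) * CoprodI.of a.2 := by
  classical
  obtain ⟨i, a⟩ := a
  obtain ⟨j, b⟩ := h
  by_cases hij : j = i
  · subst hij
    by_cases hab : b * a = 1
    · refine ⟨[], fun t ht => ⟨?_, ?_⟩⟩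
      · simpa using (isReducedList_append_iff.mp ht).1
      · simp [mul_assoc, ← map_mul, hab]
    · refine ⟨[⟨j, b * a⟩], fun t ht => ⟨?_, ?_⟩⟩
      · have := isReducedList_append_iff.mp ht
        refine isReducedList_append_iff.mpr ⟨this.1, isReducedList_singleton hab, ?_⟩
        simpa using this.2.2
      · simp [mul_assoc]
  · refine ⟨[⟨j, b⟩, ⟨i, a⟩], fun t ht => ⟨?_, ?_⟩⟩
    · have : IsReducedList ((t ++ [⟨j, b⟩]) ++ [⟨i, a⟩]) :=
        isReducedList_append_iff.mpr ⟨ht, isReducedList_singleton ha, by simpa⟩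
      simpa using this
    · simp [mul_assoc]

/-- Multiplication on the right by a short word does not change a long enough prefix. -/
theorem exists_reduced_prefix (l₁ v : List (Σ i, M i)) (hv : ∀ x ∈ v, x.2 ≠ 1) :
    ∀ l₂ : List (Σ i, M i), v.length ≤ l₂.length → IsReducedList (l₁ ++ l₂) →
      ∃ r, IsReducedList (l₁ ++ r) ∧ listEval (l₁ ++ r) = listEval (l₁ ++ l₂) * listEval v := by
  induction v with
  | nil => exact fun l₂ _ h => ⟨l₂, h, by simp⟩
  | cons a v ih =>
    intro l₂ hlen h
    have hne : l₂ ≠ [] := by rintro rfl; simp at hlen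
    obtain ⟨t, b, rfl⟩ : ∃ t b, l₂ = t ++ [b] :=
      ⟨l₂.dropLast, l₂.getLast hne, (List.dropLast_append_getLast hne).symm⟩
    obtain ⟨u, hu⟩ := exists_reduced_mul_right a b (hv a (by simp))
    obtain ⟨h1, h2⟩ := hu (l₁ ++ t) (by simpa using h)
    obtain ⟨r, h3, h4⟩ := ih (fun x hx => hv x (by simp [hx])) (t ++ u)
      (by simp at hlen ⊢; omega) (by simpa using h1)
    refine ⟨r, h3, ?_⟩
    rw [h4, ← List.append_assoc, h2]
    simp [mul_assoc]

/-- Malnormality of the factors of a free product. -/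
theorem exists_eq_of_of_conj {i j : ι} (v : List (Σ i, M i)) (hv : IsReducedList v) :
    ∀ (a : M i) (b : M j), a ≠ 1 →
      listEval v * CoprodI.of a * (listEval v)⁻¹ = CoprodI.of b →
      ∃ c : M i, listEval v = CoprodI.of c := by
  classical
  induction v using List.reverseRecOn with
  | nil => exact fun _ _ _ _ => ⟨1, by simp⟩
  | append_singleton t h ih =>
    intro a b ha hab
    obtain ⟨i', x⟩ := h
    by_cases hi : i' = i
    · subst hi
      obtain ⟨c, hc⟩ := ih (isReducedList_append_iff.mp hv).1 (x * a * x⁻¹) b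
        (by simpa using ha) (by rw [← hab]; simp [mul_assoc])
      exact ⟨c * x, by simp [hc]⟩
    · exfalso
      let inv : List (Σ i, M i) → List (Σ i, M i) := fun l =>
        (l.map fun y => ⟨y.1, y.2⁻¹⟩).reverse
      have hinv : ∀ l, IsReducedList l → IsReducedList (inv l) := by
        rintro l ⟨h1, h2⟩
        constructor
        · simp only [inv, List.mem_reverse, List.mem_map]
          rintro _ ⟨y, hy, rfl⟩
          simpa using h1 y hy
        · simp only [inv, List.isChain_reverse, List.isChain_map]
          exact h2.imp fun _ _ h => h.symm
      have hinv' : ∀ l, listEval (inv l) = (listEval l)⁻¹ := by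
        intro l
        induction l with
        | nil => simp [inv]
        | cons y l ih =>
          have : inv (y :: l) = inv l ++ [⟨y.1, y.2⁻¹⟩] := by simp [inv]
          rw [this]
          simp [ih]
      -- If the last letter of `v` is not in factor `i`, then `v a v⁻¹` is reduced of length at
      -- least three and cannot be a single letter.
      have hred : IsReducedList ((t ++ [⟨i', x⟩]) ++ ([⟨i, a⟩] ++ inv (t ++ [⟨i', x⟩]))) := by
        refine isReducedList_append_iff.mpr ⟨hv, isReducedList_append_iff.mpr
          ⟨isReducedList_singleton ha, hinv _ hv, ?_⟩, ?_⟩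
        · simpa [inv] using Ne.symm hi
        · simpa using hi
      have hb : b ≠ 1 := by
        rintro rfl
        rw [map_one, mul_inv_eq_one, mul_eq_left] at hab
        exact ha (CoprodI.of_injective _ (by simpa using hab))
      have := hred.eq_of_listEval_eq (isReducedList_singleton (a := ⟨j, b⟩) hb) (by
        rw [listEval_append, listEval_append [_], hinv', ← mul_assoc]
        simpa [mul_assoc] using hab)
      have := congrArg List.length this
      simp [inv] at this
      omega

/-- Every element of a free product is conjugate to an element of a factor or to an element
represented by a cyclically reduced word. -/
theorem exists_conj_cyclically_reduced (n : ℕ) : ∀ v : List (Σ i, M i), IsReducedList v →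
    v.length ≤ n → ∃ (c : CoprodI M) (w : List (Σ i, M i)),
      c⁻¹ * listEval v * c = listEval w ∧
        (w = [] ∨ (∃ a, w = [a]) ∨ (w ≠ [] ∧ IsReducedList (w ++ w))) := by
  classical
  induction n with
  | zero =>
    intro v _ hn
    exact ⟨1, v, by simp, Or.inl (by simpa using hn)⟩
  | succ n ih =>
    intro v hv hn
    rcases v with _ | ⟨a, v⟩
    · exact ⟨1, [], by simp, Or.inl rfl⟩
    rcases v.eq_nil_or_concat with rfl | ⟨m, b, rfl⟩
    · exact ⟨1, [a], by simp, Or.inr (Or.inl ⟨a, rfl⟩)⟩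
    rw [List.concat_eq_append] at *
    by_cases hab : b.1 = a.1
    -- The outer letters share a factor, so moving the last one to the front by conjugation merges
    -- or cancels them and shortens the word.
    · have hb : b.2⁻¹ ≠ 1 := by
        simpa using hv.1 b (by simp)
      have hm := ((isReducedList_append_iff (l := a :: m)).mp hv).1
      obtain ⟨i, a⟩ := a
      obtain ⟨j, b⟩ := b
      obtain rfl : j = i := hab
      have hm' := (isReducedList_append_iff (l := [_])).mp hm
      have key : ∃ v', IsReducedList v' ∧ v'.length ≤ n ∧
          listEval v' = CoprodI.of b * listEval (⟨j, a⟩ :: m) := by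
        by_cases hba : b * a = 1
        · refine ⟨m, hm'.2.1, by simp at hn; omega, ?_⟩
          simp [← mul_assoc, ← map_mul, hba]
        · refine ⟨⟨j, b * a⟩ :: m, ?_, by simp at hn ⊢; omega, by simp [mul_assoc]⟩
          refine (isReducedList_append_iff (l := [_])).mpr
            ⟨isReducedList_singleton hba, hm'.2.1, ?_⟩
          simpa using hm'.2.2
      obtain ⟨v', h1, h2, h3⟩ := key
      obtain ⟨c, w, hc, hw⟩ := ih v' h1 h2
      refine ⟨(CoprodI.of b)⁻¹ * c, w, ?_, hw⟩
      rw [← hc, h3]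
      simp [mul_assoc]
    · refine ⟨1, a :: (m ++ [b]), by simp, Or.inr (Or.inr ⟨by simp, ?_⟩)⟩
      refine isReducedList_append_iff.mpr ⟨hv, hv, ?_⟩
      have : (a :: (m ++ [b])).getLast? = some b := by
        rw [← List.cons_append, List.getLast?_concat]
      rw [this]
      simpa using hab

/-- A nonempty cyclically reduced word has a reduced, nonempty square, so an element of order two
would be conjugate into a factor. -/
theorem coprodI_eq_one_of_sq_eq_one (htf : ∀ i, ∀ a : M i, a ^ 2 = 1 → a = 1) (g : CoprodI M)
    (hg : g ^ 2 = 1) : g = 1 := by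
  obtain ⟨v, hv, rfl⟩ := exists_isReducedList g
  obtain ⟨c, w, hc, hw⟩ := exists_conj_cyclically_reduced _ v hv le_rfl
  have hw2 : listEval w ^ 2 = 1 := by
    have : c⁻¹ * listEval v * c = MulAut.conj c⁻¹ (listEval v) := by simp
    rw [← hc, this, ← map_pow, hg, map_one]
  have hw1 : listEval w = 1 := by
    rcases hw with rfl | ⟨a, rfl⟩ | ⟨hne, hr⟩
    · rfl
    · simp only [listEval_cons, listEval_nil, mul_one, ← map_pow] at hw2 ⊢
      rw [htf _ a.2 (CoprodI.of_injective _ (hw2.trans (map_one _).symm)), map_one]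
    · have := hr.eq_of_listEval_eq isReducedList_nil (by simpa [pow_two] using hw2)
      simp at this
      exact absurd this hne
  rw [hw1, mul_assoc, inv_mul_eq_one, eq_comm, mul_eq_right] at hc
  exact hc

end FreeProduct

/-! ### Translations along rays and stabilizers of ends. -/

section Rays

variable {ι : Type w} {M : ι → Type v} {s : ℕ → Σ i, M i}

/-- The `j` letters of `s` from position `n` on. -/
def seqSegment (s : ℕ → Σ i, M i) (n j : ℕ) : List (Σ i, M i) :=
  (List.range j).map fun i => s (n + i)

@[simp] theorem length_seqSegment (n j : ℕ) : (seqSegment s n j).length = j := by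
  simp [seqSegment]

theorem seqSegment_add (n i j : ℕ) :
    seqSegment s n (i + j) = seqSegment s n i ++ seqSegment s (n + i) j := by
  simp [seqSegment, List.range_add, add_assoc]

theorem seqSegment_succ (n j : ℕ) :
    seqSegment s n (j + 1) = s n :: seqSegment s (n + 1) j := by
  rw [add_comm, seqSegment_add]; simp [seqSegment]

@[simp] theorem seqSegment_zero (n : ℕ) : seqSegment s n 0 = [] := rfl

variable [∀ i, Group (M i)]

/-- An infinite reduced sequence of letters, that is, a ray in the free product. -/
def IsReducedSeq (s : ℕ → Σ i, M i) : Prop :=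
  ∀ n, (s n).2 ≠ 1 ∧ (s n).1 ≠ (s (n + 1)).1

/-- The `n`-th point of the ray given by `s`. -/
def rayPoint (s : ℕ → Σ i, M i) (n : ℕ) : CoprodI M := listEval (seqSegment s 0 n)

/-- Left multiplication by `g` translates a tail of the ray along itself by `d`. -/
def RayShift (s : ℕ → Σ i, M i) (g : CoprodI M) (d : ℤ) : Prop :=
  ∃ a b : ℕ, (b : ℤ) - a = d ∧ ∀ j, g * rayPoint s (a + j) = rayPoint s (b + j)

theorem rayPoint_add (n j : ℕ) :
    rayPoint s (n + j) = rayPoint s n * listEval (seqSegment s n j) := by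
  simp [rayPoint, seqSegment_add]

theorem IsReducedSeq.segment (hs : IsReducedSeq s) (n j : ℕ) :
    IsReducedList (seqSegment s n j) := by
  induction j generalizing n with
  | zero => exact isReducedList_nil
  | succ j ih =>
    rw [seqSegment_succ]
    refine (isReducedList_append_iff (l := [_])).mpr
      ⟨isReducedList_singleton (hs n).1, ih (n + 1), ?_⟩
    cases j with
    | zero => simp
    | succ j =>
      change ∀ x ∈ [s n].getLast?, ∀ y ∈ (seqSegment s (n + 1) (j + 1)).head?, x.1 ≠ y.1
      rw [seqSegment_succ]
      simpa using (hs n).2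

theorem IsReducedSeq.rayPoint_injective (hs : IsReducedSeq s) :
    Function.Injective (rayPoint s) := by
  intro m n h
  simpa using congrArg List.length ((hs.segment 0 m).eq_of_listEval_eq (hs.segment 0 n) h)

/-- Far enough along the ray, left multiplication by `g` only changes an initial part of the
reduced word. -/
theorem IsReducedSeq.exists_mul_rayPoint (hs : IsReducedSeq s) (g : CoprodI M) :
    ∃ (n : ℕ) (u : List (Σ i, M i)), u ≠ [] ∧ ∀ j, IsReducedList (u ++ seqSegment s n j) ∧
      g * rayPoint s (n + j) = listEval (u ++ seqSegment s n j) := by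
  classical
  induction g using CoprodI.induction_left with
  | one =>
    refine ⟨1, [s 0], by simp, fun j => ?_⟩
    have : [s 0] ++ seqSegment s 1 j = seqSegment s 0 (1 + j) := by
      rw [add_comm 1 j, seqSegment_succ]; rfl
    rw [this]
    exact ⟨hs.segment _ _, one_mul _⟩
  | @mul i m g ih =>
    by_cases hm : m = 1
    · simpa [hm] using ih
    obtain ⟨n, u, hu, h⟩ := ih
    obtain ⟨a, u, rfl⟩ := List.exists_cons_of_ne_nil hu
    obtain ⟨u', hu'⟩ := exists_reduced_mul_left ⟨i, m⟩ a hm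
    -- Absorbing `s n` keeps the prefix nonempty even if `u'` and `u` are empty, so the next letter
    -- never reaches the tail.
    refine ⟨n + 1, u' ++ (u ++ [s n]), by simp, fun j => ?_⟩
    obtain ⟨h1, h2⟩ := h (1 + j)
    have e : (a :: u) ++ seqSegment s n (1 + j) =
        a :: ((u ++ [s n]) ++ seqSegment s (n + 1) j) := by
      rw [add_comm 1 j, seqSegment_succ]; simp
    rw [e] at h1 h2
    obtain ⟨h3, h4⟩ := hu' _ h1
    rw [← List.append_assoc] at h3 h4
    refine ⟨h3, ?_⟩
    rw [h4, ← h2, mul_assoc, add_assoc]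

namespace RayShift

variable {g h : CoprodI M} {d e : ℤ}

theorem one : RayShift s 1 0 := ⟨0, 0, by simp, by simp⟩

theorem mul (hg : RayShift s g d) (hh : RayShift s h e) : RayShift s (g * h) (d + e) := by
  obtain ⟨a, b, rfl, hab⟩ := hg
  obtain ⟨a', b', rfl, hab'⟩ := hh
  refine ⟨a' + a, b + b', by push_cast; ring, fun j => ?_⟩
  rw [mul_assoc, add_assoc, hab', show b' + (a + j) = a + (b' + j) by omega, hab]
  congr 1; omega

theorem inv (hg : RayShift s g d) : RayShift s g⁻¹ (-d) := by
  obtain ⟨a, b, rfl, hab⟩ := hg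
  exact ⟨b, a, by ring, fun j => by rw [← hab, inv_mul_cancel_left]⟩

/-- Both elements send a common ray point to the same point, and left multiplication is determined
by one value. -/
theorem ext (hg : RayShift s g d) (hh : RayShift s h d) : g = h := by
  obtain ⟨a, b, h1, hab⟩ := hg
  obtain ⟨a', b', h2, hab'⟩ := hh
  have e1 := hab a'
  have e2 := hab' a
  rw [add_comm a' a, show b' + a = b + a' by omega, ← e1] at e2
  exact (mul_right_cancel e2).symm

theorem unique (hs : IsReducedSeq s) (hg : RayShift s g d) (hg' : RayShift s g e) : d = e := by
  obtain ⟨a, b, h1, hab⟩ := hg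
  obtain ⟨a', b', h2, hab'⟩ := hg'
  have e1 := hab a'
  have e2 := hab' a
  rw [add_comm a' a, e1] at e2
  have := hs.rayPoint_injective e2
  omega

theorem zpow (hg : RayShift s g d) (n : ℤ) : RayShift s (g ^ n) (n * d) := by
  induction n using Int.induction_on with
  | zero => simpa using one
  | succ n ih => rw [zpow_add_one, add_mul, one_mul]; exact ih.mul hg
  | pred n ih => rw [zpow_sub_one, sub_mul, one_mul]; exact ih.mul hg.inv

theorem commute (hg : RayShift s g d) (hh : RayShift s h e) : g * h = h * g :=
  (hg.mul hh).ext (add_comm e d ▸ hh.mul hg)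

theorem eq_one_iff (hs : IsReducedSeq s) (hg : RayShift s g d) : g = 1 ↔ d = 0 :=
  ⟨fun h => (hg.unique hs (h ▸ one) : d = 0), fun h => (h ▸ hg).ext one⟩

/-- An element conjugating a positive power of a translation along the ray to a positive power
fixes the end of the ray. -/
theorem of_conj_pos (hs : IsReducedSeq s) {z : CoprodI M} {L : ℕ} (hL : 0 < L)
    (hz : ∀ n, z * rayPoint s n = rayPoint s (L + n)) {m l : ℕ} (hm : 0 < m) (hl : 0 < l)
    (hg : g * z ^ m * g⁻¹ = z ^ l) : ∃ d, RayShift s g d := by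
  have hzN : ∀ N, z ^ N = rayPoint s (N * L) := by
    intro N
    induction N with
    | zero => simp [rayPoint]
    | succ N ih => rw [pow_succ', ih, hz]; congr 1; ring
  have hcomm : ∀ j, g * z ^ (m * j) = z ^ (l * j) * g := by
    intro j
    rw [pow_mul z l, ← hg, conj_pow, ← pow_mul]; group
  obtain ⟨v, hv, hvg⟩ := exists_isReducedList g
  obtain ⟨n, u, -, hu⟩ := hs.exists_mul_rayPoint g
  refine ⟨_, n, u.length, rfl, fun t => ?_⟩
  rw [(hu t).2]
  -- A power `j` so large that both sides of `hcomm j` are long words. On the left the reduced word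
  -- starts with `u` and then follows the ray from `n`; on the right multiplication by `v` leaves
  -- the first `u.length + t` letters of the ray intact. Comparing prefixes gives the shift.
  obtain ⟨j, hj⟩ : ∃ j, j = n + t + v.length + u.length := ⟨_, rfl⟩
  have h1 : j ≤ m * j * L := by
    calc j = 1 * j * 1 := by ring
      _ ≤ m * j * L := by gcongr <;> omega
  have h2 : j ≤ l * j * L := by
    calc j = 1 * j * 1 := by ring
      _ ≤ l * j * L := by gcongr <;> omega
  obtain ⟨J, hJ⟩ : ∃ J, m * j * L = n + (t + J) := ⟨m * j * L - (n + t), by omega⟩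
  obtain ⟨K, hK⟩ : ∃ K, l * j * L = (u.length + t) + (K + v.length) :=
    ⟨l * j * L - (u.length + t + v.length), by omega⟩
  have e1 := hcomm j
  rw [hzN, hzN, hJ, hK, (hu _).2] at e1
  have hseg := hs.segment 0 ((u.length + t) + (K + v.length))
  rw [seqSegment_add] at hseg
  obtain ⟨r, hr1, hr2⟩ := exists_reduced_prefix _ v hv.1 _ (by simp) hseg
  rw [← seqSegment_add, hvg] at hr2
  have e2 := (hu (t + J)).1.eq_of_listEval_eq hr1 (e1.trans hr2.symm)
  rw [seqSegment_add, ← List.append_assoc] at e2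
  rw [(List.append_inj e2 (by simp)).1]
  rfl

/-- In the absence of elements of order two, an element conjugating a nontrivial power of a
translation along the ray to a nontrivial power fixes the end of the ray. -/
theorem of_conj (htf : ∀ x : CoprodI M, x ^ 2 = 1 → x = 1) (hs : IsReducedSeq s) {z : CoprodI M}
    {L : ℕ} (hL : 0 < L) (hz : ∀ n, z * rayPoint s n = rayPoint s (L + n)) {m l : ℤ} (hm : m ≠ 0)
    (hl : l ≠ 0) (hg : g * z ^ m * g⁻¹ = z ^ l) : ∃ d, RayShift s g d := by
  have hpos : ∀ (g : CoprodI M) (m l : ℤ), 0 < m → 0 < l → g * z ^ m * g⁻¹ = z ^ l →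
      ∃ d, RayShift s g d := by
    intro g m l hm hl hg
    lift m to ℕ using hm.le
    lift l to ℕ using hl.le
    exact of_conj_pos hs hL hz (m := m) (l := l) (by omega) (by omega) (by simpa using hg)
  have hzL : RayShift s z L := ⟨0, L, by simp, fun j => by rw [zero_add]; exact hz j⟩
  have hz1 : ∀ n : ℤ, z ^ n = 1 → n = 0 := by
    intro n hn
    have := ((hzL.zpow n).eq_one_iff hs).mp hn
    rcases mul_eq_zero.mp this with h | h <;> omega
  have hginv : g * z ^ (-m) * g⁻¹ = z ^ (-l) := by
    rw [zpow_neg, zpow_neg, ← hg]; group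
  have hconj : ∀ n : ℤ, g * z ^ (m * n) * g⁻¹ = z ^ (l * n) := by
    intro n
    rw [zpow_mul z l, ← hg, conj_zpow, ← zpow_mul]
  by_cases hml : 0 < m * l
  · rcases lt_or_gt_of_ne hm with h | h
    · exact hpos g (-m) (-l) (by omega) (by nlinarith) hginv
    · exact hpos g m l h (by nlinarith) hg
  -- With opposite signs `g` would reverse the axis. Its square fixes the end with some shift `d`;
  -- since `g` commutes with `g ^ 2`, it centralizes `z ^ d`, which forces `d = 0`, so `g ^ 2 = 1`
  -- and `g = 1`.
  exfalso
  have hml : m * l < 0 := lt_of_le_of_ne (not_lt.mp hml) (mul_ne_zero hm hl)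
  have hg2 : g ^ 2 * z ^ (m * m) * (g ^ 2)⁻¹ = z ^ (l * l) := by
    rw [← hconj l, mul_comm m l, ← hconj m, pow_two]; group
  obtain ⟨d, hd⟩ := hpos (g ^ 2) (m * m) (l * l) (mul_self_pos.mpr hm) (mul_self_pos.mpr hl) hg2
  have hd0 : d = 0 := by
    have h1 : (g ^ 2) ^ (L : ℤ) = z ^ d := (hd.zpow L).ext (mul_comm d (L : ℤ) ▸ hzL.zpow d)
    have h2 : g * z ^ d * g⁻¹ = z ^ d := by
      rw [← h1]; group
    have h3 : z ^ (d * m) = z ^ (l * d) := by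
      rw [← hconj d, mul_comm m d, zpow_mul, ← conj_zpow, h2]
    have h4 : z ^ (d * m - l * d) = 1 := by rw [zpow_sub, h3, mul_inv_cancel]
    have h5 := hz1 _ h4
    have h6 : d * (m - l) = 0 := by linarith
    refine (mul_eq_zero.mp h6).resolve_right fun h => ?_
    have : m = l := by omega
    subst this
    nlinarith [mul_self_nonneg m]
  have hg1 : g = 1 := htf g ((hd.eq_one_iff hs).mpr hd0)
  rw [hg1] at hg
  have h4 : z ^ (m - l) = 1 := by
    rw [zpow_sub, ← hg]; group
  have := hz1 _ h4
  have : m = l := by omega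
  subst this
  nlinarith [mul_self_nonneg m]

end RayShift

/-- A cyclically reduced word acts as a translation on a ray. -/
theorem exists_ray_of_cyclically_reduced {w : List (Σ i, M i)} (hne : w ≠ [])
    (hw : IsReducedList (w ++ w)) : ∃ (s : ℕ → Σ i, M i) (L : ℕ), 0 < L ∧ IsReducedSeq s ∧
      ∀ n, listEval w * rayPoint s n = rayPoint s (L + n) := by
  have hL : 0 < w.length := List.length_pos_iff.mpr hne
  -- The periodic ray `w w w …`, reduced because `w ++ w` is.
  let s : ℕ → Σ i, M i := fun n => w[n % w.length]'(Nat.mod_lt _ hL)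
  have hper : ∀ n, s (w.length + n) = s n := by intro n; simp [s]
  refine ⟨s, w.length, hL, ?_, ?_⟩
  · intro n
    refine ⟨hw.1 _ (by simp [s]), ?_⟩
    have hlt := Nat.mod_lt n hL
    have h := List.isChain_iff_getElem.mp hw.2 (n % w.length) (by simp; omega)
    have e1 : (w ++ w)[n % w.length]'(by simp; omega) = s n := by
      rw [List.getElem_append_left hlt]
    have e2 : (w ++ w)[n % w.length + 1]'(by simp; omega) = s (n + 1) := by
      by_cases h1 : n % w.length + 1 < w.length
      · rw [List.getElem_append_left h1]
        simp only [s]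
        congr 1
        rw [Nat.add_mod, Nat.mod_eq_of_lt (show 1 < w.length by omega), Nat.mod_eq_of_lt h1]
      · have h2 : n % w.length + 1 = w.length := by omega
        rw [List.getElem_append_right (by omega)]
        simp only [s]
        congr 1
        rw [h2, Nat.sub_self, ← Nat.mod_add_mod, h2, Nat.mod_self]
    rwa [e1, e2] at h
  · intro n
    rw [rayPoint_add]
    congr 1
    · rw [rayPoint]
      congr 1
      apply List.ext_getElem (by simp)
      intro i h1 h2
      simp [seqSegment, s, Nat.mod_eq_of_lt h1]
    · rw [rayPoint]
      congr 1
      simp [seqSegment, hper]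

end Rays

/-! ### Nilpotent subgroups of free products and the main theorem. -/

theorem IsNilClass.range {k : ℕ} {H : Type u} {G : Type v} [Group H] [Group G]
    (h : IsNilClass k H) (f : H →* G) : IsNilClass k f.range := by
  have := h.1
  exact ⟨Group.nilpotent_of_surjective _ f.rangeRestrict_surjective,
    (Group.nilpotencyClass_le_of_surjective _ f.rangeRestrict_surjective).trans h.2⟩

theorem isNilClass_of_commute {k : ℕ} (hk : 1 ≤ k) {G : Type u} [Group G]
    (h : ∀ a b : G, a * b = b * a) : IsNilClass k G := by
  rw [isNilClass_iff, eq_bot_iff]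
  refine (Subgroup.lowerCentralSeries_antitone _ hk).trans ?_
  rw [Subgroup.lowerCentralSeries_succ, Subgroup.commutator_le]
  intro a _ b _
  rw [Subgroup.mem_bot, commutatorElement_eq_one_iff_mul_comm]
  exact h a b

theorem IsNilClass.exists_central {k : ℕ} {G : Type u} [Group G] {K : Subgroup G}
    (hK : IsNilClass k K) {h : G} (hh : h ∈ K) (h1 : h ≠ 1) :
    1 ≤ k ∧ ∃ z ∈ K, z ≠ 1 ∧ ∀ x ∈ K, x * z * x⁻¹ = z := by
  have : Nontrivial K := ⟨⟨h, hh⟩, 1, fun e => h1 (congrArg Subtype.val e)⟩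
  have hnil := hK.1
  constructor
  · by_contra hk
    obtain rfl : k = 0 := by omega
    have h2 := isNilClass_iff.mp hK
    rw [Subgroup.lowerCentralSeries_zero] at h2
    exact top_ne_bot h2
  · obtain ⟨⟨z, hz⟩, hz1⟩ := Subgroup.ne_bot_iff_exists_ne_one.mp
      (Group.IsNilpotent.center_ne_bot (G := K))
    refine ⟨z, z.2, fun e => hz1 (Subtype.ext (Subtype.ext e)), fun x hx => ?_⟩
    have := congrArg Subtype.val (Subgroup.mem_center_iff.mp hz ⟨x, hx⟩)
    rw [mul_inv_eq_iff_eq_mul]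
    exact this

/-- The elements translating a tail of the ray `s` along itself form a subgroup. -/
def rayStabilizer {ι : Type w} {M : ι → Type v} [∀ i, Group (M i)] (s : ℕ → Σ i, M i) :
    Subgroup (CoprodI M) where
  carrier := {g | ∃ d, RayShift s g d}
  one_mem' := ⟨0, RayShift.one⟩
  mul_mem' := fun ⟨_, ha⟩ ⟨_, hb⟩ => ⟨_, ha.mul hb⟩
  inv_mem' := fun ⟨_, ha⟩ => ⟨_, ha.inv⟩

theorem isNilClass_rayStabilizer {ι : Type w} {M : ι → Type v} [∀ i, Group (M i)]
    (s : ℕ → Σ i, M i) {k : ℕ} (hk : 1 ≤ k) : IsNilClass k (rayStabilizer s) :=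
  isNilClass_of_commute hk fun ⟨_, _, ha⟩ ⟨_, _, hb⟩ => Subtype.ext (ha.commute hb)

/-- In a free product of `Nil k` groups without elements of order two, a `Nil k` subgroup that
meets its conjugate by `x` nontrivially generates together with `x` a `Nil k` group. -/
theorem exists_isNilClass_of_conj_mem {ι : Type w} {M : ι → Type v} [∀ i, Group (M i)] {k : ℕ}
    (hM : ∀ i, IsNilClass k (M i)) (htf : ∀ i, ∀ a : M i, a ^ 2 = 1 → a = 1)
    {K : Subgroup (CoprodI M)} (hK : IsNilClass k K) {h x : CoprodI M} (hh : h ∈ K) (h1 : h ≠ 1)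
    (hx : x * h * x⁻¹ ∈ K) :
    ∃ N : Subgroup (CoprodI M), IsNilClass k N ∧ K ≤ N ∧ x ∈ N := by
  obtain ⟨hk, z, hzK, hz1, hz⟩ := hK.exists_central hh h1
  obtain ⟨v, hv, hvz⟩ := exists_isReducedList z
  obtain ⟨c, w, hc, hw⟩ := exists_conj_cyclically_reduced _ v hv le_rfl
  rw [hvz] at hc
  suffices H : ∃ N : Subgroup (CoprodI M), IsNilClass k N ∧ (∀ y ∈ K, c⁻¹ * y * c ∈ N) ∧
      c⁻¹ * x * c ∈ N by
    obtain ⟨N, hN, h2, h3⟩ := H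
    refine ⟨((MulAut.conj c).toMonoidHom.comp N.subtype).range, hN.range _, fun y hy => ?_, ?_⟩
    · exact ⟨⟨_, h2 y hy⟩, by simp [mul_assoc]⟩
    · exact ⟨⟨_, h3⟩, by simp [mul_assoc]⟩
  have hcen : ∀ y ∈ K, (c⁻¹ * y * c) * listEval w * (c⁻¹ * y * c)⁻¹ = listEval w := by
    intro y hy
    rw [← hc]
    calc _ = c⁻¹ * (y * z * y⁻¹) * c := by group
      _ = _ := by rw [hz y hy]
  have hw1 : listEval w ≠ 1 := by
    rw [← hc]
    intro e
    apply hz1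
    calc z = c * (c⁻¹ * z * c) * c⁻¹ := by group
      _ = 1 := by rw [e]; group
  have hx' : (c⁻¹ * x * c) * (c⁻¹ * h * c) * (c⁻¹ * x * c)⁻¹ = c⁻¹ * (x * h * x⁻¹) * c := by group
  have hc1 : ∀ g : CoprodI M, g ≠ 1 → c⁻¹ * g * c ≠ 1 := by
    intro g hg e
    apply hg
    calc g = c * (c⁻¹ * g * c) * c⁻¹ := by group
      _ = 1 := by rw [e]; group
  rcases hw with rfl | ⟨⟨i, a⟩, rfl⟩ | ⟨hne, hr⟩
  · exact absurd rfl hw1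
  · have hmal : ∀ (g : CoprodI M) (a b : M i), a ≠ 1 →
        g * CoprodI.of a * g⁻¹ = CoprodI.of b → ∃ c : M i, g = CoprodI.of c := by
      intro g a b ha hab
      obtain ⟨v, hv, rfl⟩ := exists_isReducedList g
      exact exists_eq_of_of_conj v hv a b ha hab
    have hKN : ∀ y ∈ K, ∃ b : M i, c⁻¹ * y * c = CoprodI.of b := by
      intro y hy
      refine hmal _ a a ?_ (by simpa using hcen y hy)
      rintro rfl
      simp at hw1
    refine ⟨(CoprodI.of : M i →* CoprodI M).range, (hM i).range _, fun y hy => ?_, ?_⟩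
    · obtain ⟨b, hb⟩ := hKN y hy
      exact ⟨b, hb.symm⟩
    · obtain ⟨b, hb⟩ := hKN h hh
      obtain ⟨b', hb'⟩ := hKN _ hx
      rw [hb, hb'] at hx'
      have hb1 : b ≠ 1 := by
        rintro rfl
        exact hc1 h h1 (by rw [hb, map_one])
      obtain ⟨b'', hb''⟩ := hmal _ b b' hb1 hx'
      exact ⟨b'', hb''.symm⟩
  · obtain ⟨s, L, hL, hs, hwL⟩ := exists_ray_of_cyclically_reduced hne hr
    have htfP := coprodI_eq_one_of_sq_eq_one htf
    have hshift : RayShift s (listEval w) L :=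
      ⟨0, L, by simp, fun j => by rw [zero_add]; exact hwL j⟩
    have hKN : ∀ y ∈ K, ∃ d, RayShift s (c⁻¹ * y * c) d := fun y hy =>
      RayShift.of_conj htfP hs hL hwL one_ne_zero one_ne_zero (by simpa using hcen y hy)
    refine ⟨rayStabilizer s, isNilClass_rayStabilizer s hk, hKN, ?_⟩
    obtain ⟨d, hd⟩ := hKN h hh
    obtain ⟨d', hd'⟩ := hKN _ hx
    have hd0 : d ≠ 0 := fun e => hc1 h h1 ((hd.eq_one_iff hs).mpr e)
    have hd0' : d' ≠ 0 := fun e => hc1 _ (by simpa using h1) ((hd'.eq_one_iff hs).mpr e)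
    -- Both sides have shift `d * L`, so they coincide; this turns conjugation of `h` into
    -- conjugation of powers of `w`.
    have e1 : (c⁻¹ * h * c) ^ (L : ℤ) = listEval w ^ d :=
      (hd.zpow L).ext (mul_comm d (L : ℤ) ▸ hshift.zpow d)
    have e2 : (c⁻¹ * (x * h * x⁻¹) * c) ^ (L : ℤ) = listEval w ^ d' :=
      (hd'.zpow L).ext (mul_comm d' (L : ℤ) ▸ hshift.zpow d')
    refine RayShift.of_conj htfP hs hL hwL hd0 hd0' ?_
    rw [← e1, ← e2, ← hx', conj_zpow]

theorem mainTheorem3 (k : ℕ) (A : Type v) [Group A] (hA : IsFGFreeNil k A)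
    (G : Type u) [Group G] (hG : IsFullyResiduallyAFree.{u, v, w} A G) :
    IsCSN k G := by
  classical
  have hnil : IsNilClass k A := hA.choose_spec.choose_spec.1
  intro H hH x hx
  by_contra hne
  obtain ⟨⟨h, hh, hh'⟩, hne1⟩ := Subgroup.ne_bot_iff_exists_ne_one.mp hne
  have h1 : h ≠ 1 := fun e => hne1 (Subtype.ext e)
  obtain ⟨h₀, hh₀, e⟩ := hh'
  have hxh : x * h * x⁻¹ ∈ H := by
    have : x * h * x⁻¹ = h₀ := by
      rw [← e]; simp [mul_assoc]
    rwa [this]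
  let N := H ⊔ Subgroup.zpowers x
  have hN : ¬ IsNilClass k N := by
    intro hN
    exact hx (hH.2 hN le_sup_left ((le_sup_right : _ ≤ N) (Subgroup.mem_zpowers x)))
  rw [isNilClass_iff] at hN
  -- The element `y` witnesses that `N` has class greater than `k`; preserving it under `α` detects
  -- this in the image.
  obtain ⟨⟨y, hy⟩, hyne⟩ := Subgroup.ne_bot_iff_exists_ne_one.mp hN
  have hy1 : (y : G) ≠ 1 := fun e => hyne (Subtype.ext (Subtype.ext e))
  obtain ⟨ι, _, α, hα⟩ := hG {h, (y : G)} (by simp [h1, hy1])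
  have hαh := hα h (by simp)
  have hαy := hα y (by simp)
  obtain ⟨K, hK, hHK, hxK⟩ := exists_isNilClass_of_conj_mem (fun _ : ι => hnil)
    (fun _ => hA.eq_one_of_sq_eq_one) (hH.1.range (α.comp H.subtype)) (h := α h) (x := α x)
    ⟨⟨h, hh⟩, rfl⟩ hαh ⟨⟨_, hxh⟩, by simp⟩
  have hNK : N ≤ K.comap α := by
    refine sup_le (fun g hg => hHK ⟨⟨g, hg⟩, rfl⟩) ?_
    rw [Subgroup.zpowers_le]
    exact hxK
  let β : N →* K := (α.comp N.subtype).codRestrict K fun g => hNK g.2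
  have h2 := Subgroup.mem_map_of_mem β hy
  rw [Subgroup.map_lowerCentralSeries] at h2
  have h3 : β y ∈ (⊤ : Subgroup K).lowerCentralSeries k :=
    Subgroup.lowerCentralSeries_mono k (le_top : Subgroup.map β ⊤ ≤ ⊤) h2
  rw [isNilClass_iff.mp hK, Subgroup.mem_bot] at h3
  exact hαy (congrArg Subtype.val h3)
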